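/- Let $\alpha,\beta\in\mathbb R$ satisfy $0\le\alpha\le1$, $\beta>0$ and $\alpha\beta+\frac1{2\beta}\le1$, and put $\beta_{20}=1-\frac1{2\beta}-\alpha\beta$, $\beta_{21}=\frac1{2\beta}$, $s=\frac{1-\alpha\beta+\alpha\beta^2}{\beta(1-\alpha\beta)}$. For a production-destruction system with rates $p_{ij},d_{ij}$ ($1\le i,j\le N$) and step size $\Delta t>0$, one step $\mathbf y^n\mapsto\mathbf y^{n+1}$ of the scheme SSPMPRK2($\alpha,\beta$) is given by the equations, for $i=1,\dots,N$, $$y_i^{(1)}=y_i^n+\beta\Delta t\Bigl(\sum_{j}p_{ij}(\mathbf y^n)\frac{y_j^{(1)}}{y_j^n}-\sum_{j}d_{ij}(\mathbf y^n)\frac{y_i^{(1)}}{y_i^n}\Bigr),$$ $$y_i^{n+1}=(1-\alpha)y_i^n+\alpha y_i^{(1)}+\Delta t\Bigl(\sum_j\bigl(\beta_{20}p_{ij}(\mathbf y^n)+\beta_{21}p_{ij}(\mathbf y^{(1)})\bigr)\frac{y_j^{n+1}}{(y_j^n)^{1-s}(y_j^{(1)})^s}-\sum_j\bigl(\beta_{20}d_{ij}(\mathbf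 y^n)+\beta_{21}d_{ij}(\mathbf y^{(1)})\bigr)\frac{y_i^{n+1}}{(y_i^n)^{1-s}(y_i^{(1)})^s}\Bigr).$$ Let $\mathbf A\in\mathbb R^{N\times N}$ be a Metzler matrix (nonnegative off-diagonal entries) with $\mathbf A^T\mathbf 1=\mathbf 0$. The scheme is applied to $\mathbf y'=\mathbf A\mathbf y$ with the rates $p_{ij}(\mathbf y)=d_{ji}(\mathbf y)=a_{ij}y_j$ for $i\ne j$ and $p_{ii}=d_{ii}=0$. Let $\mathbf y^*\in\mathbb R^N_{>0}$ satisfy $\mathbf A\mathbf y^*=\mathbf 0$. Put $$R(z)=\frac{-2+(2\alpha\beta^2-2\alpha\beta+1)z^2-2\beta(\alpha-1)z}{2(1+(\alpha\beta-1)z)(\beta z-1)},$$ and call $\{z\in\mathbb C\mid\operatorname{Re}z\le0,\ |R(z)|\le1\}$ the stability region of SSPMPRK2($\alpha,\beta$). For every $\Delta t>0$ and every $\mathbf y^n\in\mathbb R^N_{>0}$ the equations of the scheme have a unique solution $\mathbf y^{n+1}$, and it is positive; let $\mathbf g:\mathbb R^N_{>0}\to\mathbb R^N_{>0}$, $\mathbf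 y^{n+1}=\mathbf g(\mathbf y^n)$, be the resulting map. Then $\mathbf g(\mathbf y^*)=\mathbf y^*$. Moreover $R$ is the stability function of the scheme: $\mathbf g$ is differentiable at $\mathbf y^*$, and whenever $\mathbf A\mathbf v=\lambda\mathbf v$ with $\lambda\in\mathbb C$, $\mathbf v\in\mathbb C^N$, one has $\mathbf D\mathbf g(\mathbf y^*)\mathbf v=R(\Delta t\,\lambda)\mathbf v$. Furthermore: 1. If $\alpha>\frac1{2\beta}$, the stability region of SSPMPRK2($\alpha,\beta$) is bounded. 2. If $\alpha<\frac1{2\beta}$ and $(\alpha,\beta)\ne(0,\frac12)$, then $\mathbf y^*$ is a Lyapunov stable fixed point of $\mathbf g$ for every $\Delta t>0$. 3. If $\alpha=\frac1{2\beta}$ or $(\alpha,\beta)=(0,\frac12)$, and all nonzero eigenvalues of $\mathbf A$ have negative real part, then $\mathbf y^*$ is a Lyapunov stable fixed point of $\mathbf g$ for every $\Delta t>0$. Here $\mathbf y^*$ is Lyapunov stable if for every $\epsilon>0$ there is $\delta>0$ such that every $\mathbf y^0\in\mathbb R^N_{>0}$ with $\|\mathbf y^0-\mathbf y^*\|<\delta$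 has iterates $\mathbf y^{n+1}=\mathbf g(\mathbf y^n)$ satisfying $\|\mathbf y^n-\mathbf y^*\|<\epsilon$ for all $n\ge0$. -/

import Mathlib

namespace SSPMPRK

/-- Componentwise strict positivity of a vector: `y` lies in the open positive orthant. -/
def Positive {N : ℕ} (y : Fin N → ℝ) : Prop := ∀ i, 0 < y i

/-- A Metzler matrix: all off-diagonal entries are nonnegative. -/
def IsMetzler {N : ℕ} (A : Matrix (Fin N) (Fin N) ℝ) : Prop := ∀ i j, i ≠ j → 0 ≤ A i j

/-- Conservativity of `y' = A y`: the all-ones vector lies in the kernel of the transpose. -/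
def IsConservative {N : ℕ} (A : Matrix (Fin N) (Fin N) ℝ) : Prop :=
  Matrix.mulVec A.transpose (fun _ => (1 : ℝ)) = 0

/-- Rates `p y i j` (or `d y i j`) of a production-destruction system in `N` components. -/
abbrev Rates (N : ℕ) := (Fin N → ℝ) → Fin N → Fin N → ℝ

/-- Production rates of `y' = A y`: `p_ij(y) = a_ij y_j` for `i ≠ j` and `p_ii = 0`. -/
def linProd {N : ℕ} (A : Matrix (Fin N) (Fin N) ℝ) : Rates N :=
  fun y i j => if i = j then 0 else A i j * y j

/-- Destruction rates of `y' = A y`: `d_ij = p_ji`. -/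
def linDest {N : ℕ} (A : Matrix (Fin N) (Fin N) ℝ) : Rates N :=
  fun y i j => linProd A y j i

/-- The admissible parameters of the second order scheme. -/
def Admissible (α β : ℝ) : Prop :=
  0 ≤ α ∧ α ≤ 1 ∧ 0 < β ∧ α * β + 1 / (2 * β) ≤ 1

noncomputable def beta20 (α β : ℝ) : ℝ := 1 - 1 / (2 * β) - α * β

noncomputable def beta21 (β : ℝ) : ℝ := 1 / (2 * β)

noncomputable def sExp (α β : ℝ) : ℝ :=
  (1 - α * β + α * β ^ 2) / (β * (1 - α * β))

/-- First stage: `u = y^(1)` solves the Patankar-weighted Euler step from `y = y^n`. -/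
def Stage1 {N : ℕ} (p d : Rates N) (β Δt : ℝ) (y u : Fin N → ℝ) : Prop :=
  ∀ i, u i = y i + β * Δt *
    ((∑ j, p y i j * (u j / y j)) - ∑ j, d y i j * (u i / y i))

/-- Second stage: `z = y^(n+1)` computed from `y = y^n` and `u = y^(1)`. -/
def Stage2 {N : ℕ} (p d : Rates N) (α β Δt : ℝ) (y u z : Fin N → ℝ) : Prop :=
  ∀ i, z i = (1 - α) * y i + α * u i + Δt *
    ((∑ j, (beta20 α β * p y i j + beta21 β * p u i j) *
        (z j / (y j ^ (1 - sExp α β) * u j ^ sExp α β)))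
      - ∑ j, (beta20 α β * d y i j + beta21 β * d u i j) *
        (z i / (y i ^ (1 - sExp α β) * u i ^ sExp α β)))

/-- One step `y^n = y ↦ y^(n+1) = z` of SSPMPRK2(α,β) with step size `Δt`
for the production-destruction system with rates `p`, `d`. -/
def Step {N : ℕ} (p d : Rates N) (α β Δt : ℝ) (y z : Fin N → ℝ) : Prop :=
  ∃ u : Fin N → ℝ, Stage1 p d β Δt y u ∧ Stage2 p d α β Δt y u z

/-- `g` is the map of the positive orthant to itself generated by SSPMPRK2(α,β): for every
positive `y`, the value `g y` is positive and is the one and only solution of the scheme's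
equations. The values of `g` outside the positive orthant are irrelevant. -/
def IsSchemeMap {N : ℕ} (p d : Rates N) (α β Δt : ℝ)
    (g : (Fin N → ℝ) → (Fin N → ℝ)) : Prop :=
  ∀ y, Positive y → Positive (g y) ∧ ∀ z, Step p d α β Δt y z ↔ z = g y

/-- Lyapunov stability of a point `ystar` for the iteration `y^(n+1) = g (y^n)` started in `D`.
The norm is the maximum norm; all norms on `ℝ^N` give the same notion. -/
def LyapunovStable {N : ℕ} (D : Set (Fin N → ℝ)) (g : (Fin N → ℝ) → (Fin N → ℝ))
    (ystar : Fin N → ℝ) : Prop :=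
  ∀ ε > 0, ∃ δ > 0, ∀ y0 ∈ D, ‖y0 - ystar‖ < δ → ∀ n : ℕ, ‖g^[n] y0 - ystar‖ < ε

/-- A real matrix regarded as a complex one. -/
def toComplex {N : ℕ} (A : Matrix (Fin N) (Fin N) ℝ) : Matrix (Fin N) (Fin N) ℂ :=
  A.map (fun x : ℝ => (x : ℂ))

/-- `μ` is a (complex) eigenvalue of the real matrix `A`. -/
def IsEigenvalue {N : ℕ} (A : Matrix (Fin N) (Fin N) ℝ) (μ : ℂ) : Prop :=
  Module.End.HasEigenvalue (Matrix.toLin' (toComplex A)) μ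

/-- The Jacobian matrix of `g` at `y` (meaningful where `g` is differentiable). -/
noncomputable def jacobian {N : ℕ} (g : (Fin N → ℝ) → (Fin N → ℝ)) (y : Fin N → ℝ) :
    Matrix (Fin N) (Fin N) ℝ :=
  LinearMap.toMatrix' (fderiv ℝ g y : (Fin N → ℝ) →ₗ[ℝ] (Fin N → ℝ))

/-- The stability function of SSPMPRK2(α,β). -/
noncomputable def stabFun (α β : ℝ) (z : ℂ) : ℂ :=
  (-2 + (2 * α * β ^ 2 - 2 * α * β + 1) * z ^ 2 - 2 * β * (α - 1) * z) /
    (2 * (1 + (α * β - 1) * z) * (β * z - 1))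

/-- The stability region: points of the closed left half-plane where `|R| ≤ 1`. -/
def stabRegion (α β : ℝ) : Set ℂ := {z | z.re ≤ 0 ∧ ‖stabFun α β z‖ ≤ 1}

end SSPMPRK

open Matrix Filter Topology

/-! ### Linear solves with conservative Metzler matrices -/

namespace SSPMPRK

variable {N : ℕ} {A : Matrix (Fin N) (Fin N) ℝ}

/-! For the linear rates each stage is a linear system `z = b + B *ᵥ (w * z)` with `B = Δt • A` and
nonnegative weights `w`. Since `B` is Metzler with zero column sums, such a system is uniquely
solvable and preserves positivity. So `g` is the explicit map `stepMap`, smooth on the positive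
orthant, and it fixes every positive vector of `ker A`.

Differentiating the stage equations at the steady state shows that the Jacobian `J` is a rational
function of `B` (`resolvent_mul_jacobian`). Hence `J` commutes with `A` and acts on eigenvectors
through `stabFun`.

The steady state is not isolated and `J` is the identity on `ker A`, so linearization alone does not
decide stability. The form of `A` weighted by the inverse of the steady state is dissipative, which
makes the eigenvalue 0 semisimple and puts all other eigenvalues in the open left half-plane. A
commuting generalized inverse `X` then gives the projection `P = 1 - A * X` onto `ker A` along the
range of `A`, and conservation gives `P (g y) = P y`. For `α ≤ 1 / (2 * β)` one has `|R| < 1` on the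
open left half-plane, so a power of `J` contracts the range of `A`, and orbits stay close to the
fixed point `P y` (`stable_of_hasStrictFDerivAt`).

For `α > 1 / (2 * β)` the leading coefficients of `R` give `|R| > 1` near infinity. -/

theorem IsConservative.sum_col (hC : IsConservative A) (j : Fin N) : ∑ i, A i j = 0 := by
  simpa [mulVec, dotProduct] using congrFun hC j

theorem IsMetzler.smul (hM : IsMetzler A) {τ : ℝ} (hτ : 0 ≤ τ) : IsMetzler (τ • A) :=
  fun i j hij => mul_nonneg hτ (hM i j hij)

theorem IsConservative.smul (hC : IsConservative A) (τ : ℝ) : IsConservative (τ • A) := by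
  unfold IsConservative at *
  rw [transpose_smul, smul_mulVec, hC, smul_zero]

/-- Production minus destruction of a linear conservative system is the matrix-vector product. -/
theorem sum_prod_sub_sum_dest (hC : IsConservative A) (x : Fin N → ℝ) (i : Fin N) :
    (∑ j, if i = j then 0 else A i j * x j) - (∑ j, if j = i then 0 else A j i * x i) =
      (A *ᵥ x) i := by
  have h1 : ∀ j, (if i = j then 0 else A i j * x j) =
      A i j * x j - if i = j then A i j * x j else 0 := by
    intro j; split_ifs <;> simp
  have h2 : ∀ j, (if j = i then 0 else A j i * x i) =
      A j i * x i - if j = i then A j i * x i else 0 := by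
    intro j; split_ifs <;> simp
  simp only [h1, h2, Finset.sum_sub_distrib, Finset.sum_ite_eq, Finset.sum_ite_eq',
    Finset.mem_univ, if_true, ← Finset.sum_mul, hC.sum_col]
  simp [mulVec, dotProduct]

/-- Sum the equations over the set `S` of negative components. The sum of `A i j` over `i ∈ S` is
nonpositive for `j ∈ S`, because the whole column sums to zero, and nonnegative for `j ∉ S`. Both
signs match that of `z j`, so a negative left side would equal a nonnegative right side. -/
theorem nonneg_of_eq_add_mulVec (hM : IsMetzler A) (hC : IsConservative A)
    {w b z : Fin N → ℝ} (hw : ∀ i, 0 ≤ w i) (hb : ∀ i, 0 ≤ b i)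
    (hz : z = b + A *ᵥ (w * z)) (i : Fin N) : 0 ≤ z i := by
  by_contra! hi
  set S := Finset.univ.filter fun i => z i < 0 with hS
  have key : ∑ i ∈ S, z i = ∑ i ∈ S, b i + ∑ j, (∑ i ∈ S, A i j) * (w j * z j) := by
    simp only [Finset.sum_mul]
    rw [Finset.sum_comm, ← Finset.sum_add_distrib]
    refine Finset.sum_congr rfl fun i _ => ?_
    simpa [mulVec, dotProduct] using congrFun hz i
  have h1 : ∑ i ∈ S, z i < 0 :=
    Finset.sum_neg (fun i hi => (Finset.mem_filter.1 hi).2) ⟨i, by simpa [hS] using hi⟩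
  have h2 : 0 ≤ ∑ i ∈ S, b i := Finset.sum_nonneg fun i _ => hb i
  have h3 : 0 ≤ ∑ j, (∑ i ∈ S, A i j) * (w j * z j) := by
    refine Finset.sum_nonneg fun j _ => ?_
    by_cases hj : z j < 0
    · refine mul_nonneg_of_nonpos_of_nonpos ?_
        (mul_nonpos_of_nonneg_of_nonpos (hw j) hj.le)
      have hc := hC.sum_col j
      rw [← Finset.sum_add_sum_compl S] at hc
      have : 0 ≤ ∑ i ∈ Sᶜ, A i j := Finset.sum_nonneg fun i hi => hM i j <| by
        rintro rfl
        simp [hS] at hi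
        linarith
      linarith
    · refine mul_nonneg (Finset.sum_nonneg fun i hi => hM i j ?_)
        (mul_nonneg (hw j) (not_lt.1 hj))
      rintro rfl
      exact hj (by simpa [hS] using hi)
  linarith

theorem pos_of_eq_add_mulVec (hM : IsMetzler A) (hC : IsConservative A)
    {w b z : Fin N → ℝ} (hw : ∀ i, 0 ≤ w i) (hb : Positive b)
    (hz : z = b + A *ᵥ (w * z)) : Positive z := by
  intro i
  have hn := nonneg_of_eq_add_mulVec hM hC hw (fun i => (hb i).le) hz
  refine (hn i).lt_of_ne' fun h0 => ?_
  have h := congrFun hz i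
  have : 0 ≤ (A *ᵥ (w * z)) i := by
    change 0 ≤ ∑ j, A i j * (w j * z j)
    refine Finset.sum_nonneg fun j _ => ?_
    by_cases hj : i = j
    · subst hj; simp [h0]
    · exact mul_nonneg (hM i j hj) (mul_nonneg (hw j) (hn j))
  simp only [Pi.add_apply, h0] at h
  linarith [hb i]

theorem eq_zero_of_eq_mulVec (hM : IsMetzler A) (hC : IsConservative A)
    {w z : Fin N → ℝ} (hw : ∀ i, 0 ≤ w i) (hz : z = A *ᵥ (w * z)) : z = 0 := by
  ext i
  refine le_antisymm ?_ (nonneg_of_eq_add_mulVec (b := 0) hM hC hw (by simp) (by simpa) i)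
  have := nonneg_of_eq_add_mulVec (b := 0) (z := -z) hM hC hw (by simp)
    (by rw [zero_add, mul_neg, mulVec_neg, ← hz]) i
  simpa using this

/-- The endomorphism `z ↦ z - A (w z)` with `w` acting componentwise. -/
noncomputable def resolventOp (A : Matrix (Fin N) (Fin N) ℝ) (w : Fin N → ℝ) :
    (Fin N → ℝ) →L[ℝ] (Fin N → ℝ) :=
  1 - (LinearMap.toContinuousLinearMap A.mulVecLin) ∘L ContinuousLinearMap.mul ℝ (Fin N → ℝ) w

theorem resolventOp_apply (w z : Fin N → ℝ) : resolventOp A w z = z - A *ᵥ (w * z) := rfl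

theorem isUnit_resolventOp (hM : IsMetzler A) (hC : IsConservative A)
    {w : Fin N → ℝ} (hw : ∀ i, 0 ≤ w i) : IsUnit (resolventOp A w) := by
  have hinj : Function.Injective (resolventOp A w) := by
    rw [injective_iff_map_eq_zero]
    intro z hz
    rw [resolventOp_apply, sub_eq_zero] at hz
    exact eq_zero_of_eq_mulVec hM hC hw hz
  rw [ContinuousLinearMap.isUnit_iff_bijective]
  exact ⟨hinj, LinearMap.surjective_of_injective
    (f := (resolventOp A w : (Fin N → ℝ) →ₗ[ℝ] (Fin N → ℝ))) hinj⟩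

theorem resolventOp_eq_iff (hM : IsMetzler A) (hC : IsConservative A)
    {w b z : Fin N → ℝ} (hw : ∀ i, 0 ≤ w i) :
    z = b + A *ᵥ (w * z) ↔ z = Ring.inverse (resolventOp A w) b := by
  have hu := isUnit_resolventOp hM hC hw
  have e1 : ∀ x, resolventOp A w (Ring.inverse (resolventOp A w) x) = x := fun x => by
    rw [← mul_apply_eq_comp, Ring.mul_inverse_cancel _ hu]; rfl
  have e2 : ∀ x, Ring.inverse (resolventOp A w) (resolventOp A w x) = x := fun x => by
    rw [← mul_apply_eq_comp, Ring.inverse_mul_cancel _ hu]; rfl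
  rw [← sub_eq_iff_eq_add, ← resolventOp_apply]
  constructor
  · rintro rfl
    exact (e2 z).symm
  · rintro rfl
    exact e1 b

end SSPMPRK

/-! ### The scheme as an explicit map -/

namespace SSPMPRK

variable {N : ℕ} {A : Matrix (Fin N) (Fin N) ℝ}

/-- The Patankar weights of the second stage. -/
noncomputable def weight (α β : ℝ) (y u : Fin N → ℝ) : Fin N → ℝ :=
  fun j => (beta20 α β * y j + beta21 β * u j) / (y j ^ (1 - sExp α β) * u j ^ sExp α β)

theorem Admissible.beta20_nonneg {α β : ℝ} (h : Admissible α β) : 0 ≤ beta20 α β := by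
  unfold beta20; linarith [h.2.2.2]

theorem Admissible.beta21_pos {α β : ℝ} (h : Admissible α β) : 0 < beta21 β := by
  have := h.2.2.1
  unfold beta21; positivity

theorem beta20_add_beta21 (α β : ℝ) : beta20 α β + beta21 β = 1 - α * β := by
  unfold beta20 beta21; ring

theorem Admissible.one_sub_pos {α β : ℝ} (h : Admissible α β) : 0 < 1 - α * β := by
  rw [← beta20_add_beta21]
  exact add_pos_of_nonneg_of_pos h.beta20_nonneg h.beta21_pos

theorem Admissible.half_le {α β : ℝ} (h : Admissible α β) : 1 / 2 ≤ β := by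
  obtain ⟨h0, -, hβ, h1⟩ := h
  have h2 : 1 / (2 * β) ≤ 1 := by nlinarith [mul_nonneg h0 hβ.le]
  rw [div_le_one (by positivity)] at h2
  linarith

theorem weight_nonneg {α β : ℝ} (h : Admissible α β) {y u : Fin N → ℝ} (hy : Positive y)
    (hu : Positive u) (j : Fin N) : 0 ≤ weight α β y u j := by
  have := h.beta20_nonneg
  have := h.beta21_pos
  have := hy j
  have := hu j
  unfold weight
  positivity

theorem weight_self (α β : ℝ) {y : Fin N → ℝ} (hy : Positive y) :
    weight α β y y = fun _ => 1 - α * β := by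
  ext j
  have h := hy j
  rw [weight, ← Real.rpow_add h, ← add_mul, beta20_add_beta21]
  simp [h.ne']

/-- The Patankar quotient cancels the factor `y j` of the linear rate, so the first stage is an
implicit Euler step, linear in `y`. -/
theorem stage1_iff (hC : IsConservative A) {β τ : ℝ} {y u : Fin N → ℝ} (hy : Positive y) :
    Stage1 (linProd A) (linDest A) β τ y u ↔ u = y + (τ • A) *ᵥ ((fun _ => β) * u) := by
  rw [funext_iff]
  refine forall_congr' fun i => ?_
  have e : (fun _ => β) * u = β • u := by ext; simp
  rw [e, mulVec_smul, smul_mulVec, smul_smul, Pi.add_apply, Pi.smul_apply, smul_eq_mul,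
    ← sum_prod_sub_sum_dest hC u i]
  have h1 : ∀ j, linProd A y i j * (u j / y j) = if i = j then 0 else A i j * u j := fun j => by
    have := (hy j).ne'
    unfold linProd
    split_ifs
    · simp
    · field_simp
  have h2 : ∀ j, linDest A y i j * (u i / y i) = if j = i then 0 else A j i * u i := fun j => by
    have := (hy i).ne'
    unfold linDest linProd
    split_ifs
    · simp
    · field_simp
  simp only [h1, h2]

theorem stage2_iff (hC : IsConservative A) {α β τ : ℝ} {y u z : Fin N → ℝ} :
    Stage2 (linProd A) (linDest A) α β τ y u z ↔
      z = ((1 - α) • y + α • u) + (τ • A) *ᵥ (weight α β y u * z) := by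
  rw [funext_iff]
  refine forall_congr' fun i => ?_
  rw [smul_mulVec, Pi.add_apply, Pi.add_apply, Pi.smul_apply, Pi.smul_apply, Pi.smul_apply,
    smul_eq_mul, smul_eq_mul, smul_eq_mul, ← sum_prod_sub_sum_dest hC (weight α β y u * z) i]
  have h1 : ∀ j, (beta20 α β * linProd A y i j + beta21 β * linProd A u i j) *
        (z j / (y j ^ (1 - sExp α β) * u j ^ sExp α β)) =
      if i = j then 0 else A i j * (weight α β y u * z) j := fun j => by
    simp only [linProd, weight, Pi.mul_apply]
    split_ifs
    · simp
    · ring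
  have h2 : ∀ j, (beta20 α β * linDest A y i j + beta21 β * linDest A u i j) *
        (z i / (y i ^ (1 - sExp α β) * u i ^ sExp α β)) =
      if j = i then 0 else A j i * (weight α β y u * z) i := fun j => by
    simp only [linDest, linProd, weight, Pi.mul_apply]
    split_ifs
    · simp
    · ring
  simp only [h1, h2]

/-- The first stage as a linear map of `y`; `B` is the matrix of the problem times the step size. -/
noncomputable def stageMap (B : Matrix (Fin N) (Fin N) ℝ) (β : ℝ) :
    (Fin N → ℝ) →L[ℝ] (Fin N → ℝ) :=
  Ring.inverse (resolventOp B fun _ => β)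

/-- One step of the scheme as an explicit map. -/
noncomputable def stepMap (B : Matrix (Fin N) (Fin N) ℝ) (α β : ℝ) (y : Fin N → ℝ) : Fin N → ℝ :=
  Ring.inverse (resolventOp B (weight α β y (stageMap B β y)))
    ((1 - α) • y + α • stageMap B β y)

section

variable {B : Matrix (Fin N) (Fin N) ℝ} {α β : ℝ}

theorem stageMap_eq (hM : IsMetzler B) (hC : IsConservative B) (hβ : 0 ≤ β) (y : Fin N → ℝ) :
    stageMap B β y = y + B *ᵥ ((fun _ => β) * stageMap B β y) :=
  (resolventOp_eq_iff hM hC fun _ => hβ).2 rfl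

theorem stageMap_pos (hM : IsMetzler B) (hC : IsConservative B) (hβ : 0 ≤ β) {y : Fin N → ℝ}
    (hy : Positive y) : Positive (stageMap B β y) :=
  pos_of_eq_add_mulVec hM hC (fun _ => hβ) hy (stageMap_eq hM hC hβ y)

theorem convex_pos (h : Admissible α β) {y u : Fin N → ℝ} (hy : Positive y) (hu : Positive u) :
    Positive ((1 - α) • y + α • u) := by
  intro i
  have h0 := h.1
  have h1 := h.2.1
  have := hy i
  have := hu i
  simp only [Pi.add_apply, Pi.smul_apply, smul_eq_mul]
  rcases h0.eq_or_lt with h2 | h2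
  · rw [← h2]; linarith
  · have : 0 ≤ (1 - α) * y i := mul_nonneg (by linarith) (hy i).le
    have : 0 < α * u i := by positivity
    linarith

theorem stepMap_eq (h : Admissible α β) (hM : IsMetzler B) (hC : IsConservative B)
    {y : Fin N → ℝ} (hy : Positive y) :
    stepMap B α β y = ((1 - α) • y + α • stageMap B β y) +
      B *ᵥ (weight α β y (stageMap B β y) * stepMap B α β y) :=
  (resolventOp_eq_iff hM hC (weight_nonneg h hy (stageMap_pos hM hC h.2.2.1.le hy))).2 rfl

theorem stepMap_pos (h : Admissible α β) (hM : IsMetzler B) (hC : IsConservative B)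
    {y : Fin N → ℝ} (hy : Positive y) : Positive (stepMap B α β y) :=
  have hu := stageMap_pos hM hC h.2.2.1.le hy
  pos_of_eq_add_mulVec hM hC (weight_nonneg h hy hu) (convex_pos h hy hu) (stepMap_eq h hM hC hy)

theorem stageMap_of_mulVec_eq_zero (hM : IsMetzler B) (hC : IsConservative B) (hβ : 0 ≤ β)
    {y : Fin N → ℝ} (hy : B *ᵥ y = 0) : stageMap B β y = y := by
  refine ((resolventOp_eq_iff hM hC fun _ => hβ).1 ?_).symm
  have e : (fun _ => β) * y = β • y := by ext; simp
  rw [e, mulVec_smul, hy, smul_zero, add_zero]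

theorem stepMap_of_mulVec_eq_zero (h : Admissible α β) (hM : IsMetzler B) (hC : IsConservative B)
    {y : Fin N → ℝ} (hpos : Positive y) (hy : B *ᵥ y = 0) : stepMap B α β y = y := by
  have hu := stageMap_of_mulVec_eq_zero hM hC h.2.2.1.le hy
  refine ((resolventOp_eq_iff hM hC (weight_nonneg h hpos (hu.symm ▸ hpos))).1 ?_).symm
  have e : (fun _ => 1 - α * β) * y = (1 - α * β) • y := by ext; simp
  rw [hu, weight_self α β hpos, e, mulVec_smul, hy, smul_zero, add_zero, ← add_smul]
  simp

theorem step_iff (h : Admissible α β) (hM : IsMetzler A) (hC : IsConservative A) {τ : ℝ}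
    (hτ : 0 < τ) {y z : Fin N → ℝ} (hy : Positive y) :
    Step (linProd A) (linDest A) α β τ y z ↔ z = stepMap (τ • A) α β y := by
  have hM' := hM.smul hτ.le
  have hC' := hC.smul τ
  have hβ := h.2.2.1.le
  unfold Step
  simp only [stage1_iff hC hy, stage2_iff hC, resolventOp_eq_iff hM' hC' fun _ => hβ]
  rw [exists_eq_left]
  exact resolventOp_eq_iff hM' hC' (weight_nonneg h hy (stageMap_pos hM' hC' hβ hy))

theorem isSchemeMap_stepMap (h : Admissible α β) (hM : IsMetzler A) (hC : IsConservative A) {τ : ℝ}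
    (hτ : 0 < τ) : IsSchemeMap (linProd A) (linDest A) α β τ (stepMap (τ • A) α β) :=
  fun _ hy => ⟨stepMap_pos h (hM.smul hτ.le) (hC.smul τ) hy, fun _ => step_iff h hM hC hτ hy⟩

theorem IsSchemeMap.eq_stepMap (h : Admissible α β) (hM : IsMetzler A) (hC : IsConservative A)
    {τ : ℝ} (hτ : 0 < τ) {g : (Fin N → ℝ) → (Fin N → ℝ)}
    (hg : IsSchemeMap (linProd A) (linDest A) α β τ g) {y : Fin N → ℝ} (hy : Positive y) :
    g y = stepMap (τ • A) α β y :=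
  (((hg y hy).2 _).1 ((step_iff h hM hC hτ hy).2 rfl)).symm

/-- Each stage adds an element of the range of `B` to a combination of earlier values with
coefficients summing to one, so every linear invariant of the system is kept. -/
theorem mulVec_stepMap (h : Admissible α β) (hM : IsMetzler B) (hC : IsConservative B)
    {P : Matrix (Fin N) (Fin N) ℝ} (hP : P * B = 0) {y : Fin N → ℝ} (hy : Positive y) :
    P *ᵥ stepMap B α β y = P *ᵥ y := by
  have e : ∀ x, P *ᵥ (B *ᵥ x) = 0 := fun x => by rw [mulVec_mulVec, hP, zero_mulVec]
  rw [stepMap_eq h hM hC hy, mulVec_add, e, add_zero, mulVec_add, mulVec_smul, mulVec_smul,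
    stageMap_eq hM hC h.2.2.1.le y, mulVec_add, e, add_zero, ← add_smul]
  simp

end

end SSPMPRK

/-! ### Stability on a manifold of fixed points -/

/-- Stability of a fixed point lying on a manifold of fixed points: `P` is a projection that is
invariant under `g` and has fixed points of `g` as values, and some power of the derivative is
a contraction on the kernel of `P`. -/
theorem stable_of_hasStrictFDerivAt {E : Type*} [NormedAddCommGroup E] [NormedSpace ℝ E]
    {g : E → E} {L P : E →L[ℝ] E} {D : Set E} {p : E} (hD : D ∈ 𝓝 p) (hmaps : Set.MapsTo g D D)
    (hg : HasStrictFDerivAt g L p) (hgp : g p = p) (hPp : P p = p)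
    (hPg : ∀ y ∈ D, P (g y) = P y) (hfix : ∀ y ∈ D, P y ∈ D → g (P y) = P y)
    (hL : ∃ m, 0 < m ∧ ∀ x, ‖(L ^ m) (x - P x)‖ ≤ 1 / 2 * ‖x - P x‖) :
    ∀ ε > 0, ∃ δ > 0, ∀ y ∈ D, ‖y - p‖ < δ → ∀ n : ℕ, ‖g^[n] y - p‖ < ε := by
  obtain ⟨m, hm, hLm⟩ := hL
  intro ε hε
  have hgm : HasStrictFDerivAt g^[m] (L ^ m) p := hg.iterate hgp m
  have hiter : ∀ k, Tendsto g^[k] (𝓝 p) (𝓝 p) := fun k => by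
    have := (hg.iterate hgp k).continuousAt.tendsto
    rwa [Function.iterate_fixed hgp] at this
  have hPt : Tendsto P (𝓝 p) (𝓝 p) := by simpa [hPp] using P.continuous.tendsto p
  -- Strict differentiability compares `y` with `P y`, so the error is measured by `‖y - P y‖`
  -- rather than `‖y - p‖`. Together with the factor 1/2 in `hLm` it gives total factor 1: the
  -- distance to `P y` does not grow over a block of `m` steps.
  have hcontr : ∀ᶠ y in 𝓝 p, ‖g^[m] y - g^[m] (P y) - (L ^ m) (y - P y)‖ ≤ 1 / 2 * ‖y - P y‖ :=
    (tendsto_id.prodMk_nhds hPt).eventually (hgm.isLittleO.def (by norm_num : (0 : ℝ) < 1 / 2))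
  have hnear : ∀ᶠ y in 𝓝 p, ∀ k ∈ Finset.range m, ‖g^[k] y - p‖ < ε := by
    rw [Finset.eventually_all]
    intro k _
    simpa [dist_eq_norm] using (hiter k).eventually (Metric.ball_mem_nhds p hε)
  obtain ⟨r, hr, hball⟩ := Metric.eventually_nhds_iff.1 ((hcontr.and hnear).and (hPt hD))
  obtain ⟨δ, hδ, hPδ⟩ := Metric.tendsto_nhds_nhds.1 hPt (r / 4) (by positivity)
  refine ⟨min δ (r / 4), by positivity, fun y hy hyδ n => ?_⟩
  have hmem : ∀ n, g^[n] y ∈ D := fun n => hmaps.iterate n hy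
  have hPn : ∀ n, P (g^[n] y) = P y := by
    intro n
    induction n with
    | zero => rfl
    | succ n ih => rw [Function.iterate_succ_apply', hPg _ (hmem n), ih]
  have hyδ1 : ‖y - p‖ < δ := hyδ.trans_le (min_le_left _ _)
  have hyδ2 : ‖y - p‖ < r / 4 := hyδ.trans_le (min_le_right _ _)
  have hx : ‖P y - p‖ < r / 4 := by
    simpa [dist_eq_norm] using hPδ (by simpa [dist_eq_norm] using hyδ1)
  have hxy : ‖y - P y‖ < r / 2 := by
    calc ‖y - P y‖ = ‖(y - p) - (P y - p)‖ := by congr 1; abel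
      _ ≤ ‖y - p‖ + ‖P y - p‖ := norm_sub_le _ _
      _ < r / 2 := by linarith
  have hclose : ∀ z, ‖z - P y‖ < r / 2 → dist z p < r := fun z hz => by
    calc dist z p = ‖(z - P y) + (P y - p)‖ := by rw [dist_eq_norm]; congr 1; abel
      _ ≤ ‖z - P y‖ + ‖P y - p‖ := norm_add_le _ _
      _ < r := by linarith
  have hPyD : P y ∈ D := (hball (hclose y hxy)).2
  have hfixm : g^[m] (P y) = P y := Function.iterate_fixed (hfix y hy hPyD) m
  have hblock : ∀ q : ℕ, ‖g^[m * q] y - P y‖ < r / 2 := by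
    intro q
    induction q with
    | zero => simpa using hxy
    | succ q ih =>
      have hc := (hball (hclose _ ih)).1.1
      rw [hPn, hfixm] at hc
      have hl := hLm (g^[m * q] y)
      rw [hPn] at hl
      rw [Nat.mul_succ, add_comm, Function.iterate_add_apply]
      have := norm_sub_norm_le (g^[m] (g^[m * q] y) - P y) ((L ^ m) (g^[m * q] y - P y))
      linarith
  -- Split `n` into full blocks of length `m` and a remainder below `m`, which `hnear` controls.
  have := (hball (hclose _ (hblock (n / m)))).1.2 (n % m) (Finset.mem_range.2 (Nat.mod_lt n hm))
  rwa [← Function.iterate_add_apply, Nat.mod_add_div] at this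

/-! ### Smoothness of the step and its Jacobian at a steady state -/

namespace SSPMPRK

variable {N : ℕ} {B : Matrix (Fin N) (Fin N) ℝ} {α β : ℝ}

theorem contDiff_resolventOp (B : Matrix (Fin N) (Fin N) ℝ) {n : WithTop ℕ∞} :
    ContDiff ℝ n (resolventOp B) :=
  contDiff_const.sub (contDiff_const.clm_comp (ContinuousLinearMap.contDiff _))

theorem contDiffAt_weight (α β : ℝ) (U : (Fin N → ℝ) →L[ℝ] (Fin N → ℝ)) {y : Fin N → ℝ}
    (hy : Positive y) (hu : Positive (U y)) {n : WithTop ℕ∞} :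
    ContDiffAt ℝ n (fun x => weight α β x (U x)) y := by
  rw [contDiffAt_pi]
  intro j
  have h1 : ContDiffAt ℝ n (fun x : Fin N → ℝ => x j) y := (contDiff_apply ℝ ℝ j).contDiffAt
  have h2 : ContDiffAt ℝ n (fun x : Fin N → ℝ => U x j) y :=
    ((contDiff_apply ℝ ℝ j).comp U.contDiff).contDiffAt
  exact ((contDiffAt_const.mul h1).add (contDiffAt_const.mul h2)).div
    ((h1.rpow_const_of_ne (hy j).ne').mul (h2.rpow_const_of_ne (hu j).ne'))
    (mul_pos (Real.rpow_pos_of_pos (hy j) _) (Real.rpow_pos_of_pos (hu j) _)).ne'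

theorem contDiffAt_stepMap (h : Admissible α β) (hM : IsMetzler B) (hC : IsConservative B)
    {y : Fin N → ℝ} (hy : Positive y) {n : WithTop ℕ∞} : ContDiffAt ℝ n (stepMap B α β) y := by
  have hu := stageMap_pos hM hC h.2.2.1.le hy
  obtain ⟨T, hT⟩ := isUnit_resolventOp hM hC (weight_nonneg h hy hu)
  have h1 : ContDiffAt ℝ n
      (fun x => Ring.inverse (resolventOp B (weight α β x (stageMap B β x)))) y := by
    refine ContDiffAt.comp (g := Ring.inverse) y ?_
      ((contDiff_resolventOp B).contDiffAt.comp y (contDiffAt_weight α β _ hy hu))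
    rw [← hT]
    exact contDiffAt_ringInverse ℝ T
  have h2 : ContDiff ℝ n fun x => (1 - α) • x + α • stageMap B β x :=
    (contDiff_id.const_smul (1 - α)).add ((stageMap B β).contDiff.const_smul α)
  exact h1.clm_apply h2.contDiffAt

/-- At `y = u` the denominator, a weighted geometric mean, has value `y j` and derivative `(1 - s) *
h j + s * k j`; the rest is the quotient rule. -/
theorem hasDerivAt_weight (α β : ℝ) {y : Fin N → ℝ} (hy : Positive y) (h k : Fin N → ℝ) :
    HasDerivAt (fun t : ℝ => weight α β (y + t • h) (y + t • k))
      (fun j => (beta20 α β * h j + beta21 β * k j +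
        (1 - α * β) * ((sExp α β - 1) * h j - sExp α β * k j)) / y j) 0 := by
  rw [hasDerivAt_pi]
  intro j
  have hj := hy j
  have line : ∀ x : Fin N → ℝ, HasDerivAt (fun t : ℝ => (y + t • x) j) (x j) 0 := fun x => by
    simpa using ((hasDerivAt_id (0 : ℝ)).mul_const (x j)).const_add (y j)
  have e : ∀ x : Fin N → ℝ, (y + (0 : ℝ) • x) j = y j := fun x => by simp
  have hn : ∀ x : Fin N → ℝ, (y + (0 : ℝ) • x) j ≠ 0 := fun x => by rw [e]; exact hj.ne'
  have hd := ((((line h).const_mul (beta20 α β)).add ((line k).const_mul (beta21 β))).div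
    (((line h).rpow_const (p := 1 - sExp α β) (Or.inl (hn h))).mul
      ((line k).rpow_const (p := sExp α β) (Or.inl (hn k))))
    (by rw [Pi.mul_apply, e, e]; exact (mul_pos (Real.rpow_pos_of_pos hj _) (Real.rpow_pos_of_pos hj _)).ne'))
  refine hd.congr_deriv ?_
  simp only [Pi.add_apply, Pi.mul_apply, zero_smul, Pi.zero_apply, add_zero, Pi.smul_apply, smul_eq_mul, zero_mul]
  have hs : y j ^ (1 - sExp α β) * y j ^ sExp α β = y j := by
    rw [← Real.rpow_add hj]; simp
  have hs1 : y j ^ (1 - sExp α β - 1) = y j ^ (1 - sExp α β) / y j := by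
    rw [Real.rpow_sub_one hj.ne']
  have hs2 : y j ^ (sExp α β - 1) = y j ^ sExp α β / y j := by
    rw [Real.rpow_sub_one hj.ne']
  rw [hs1, hs2, ← beta20_add_beta21]
  generalize sExp α β = s at *
  generalize beta20 α β = b at *
  generalize beta21 β = c at *
  rw [hs]
  have e1 : h j * (1 - s) * (y j ^ (1 - s) / y j) * y j ^ s = h j * (1 - s) := by
    rw [mul_assoc, div_mul_eq_mul_div, hs, div_self hj.ne', mul_one]
  have e2 : y j ^ (1 - s) * (k j * s * (y j ^ s / y j)) = k j * s := by
    rw [show y j ^ (1 - s) * (k j * s * (y j ^ s / y j)) =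
      k j * s * ((y j ^ (1 - s) * y j ^ s) / y j) by ring, hs, div_self hj.ne', mul_one]
  rw [e1, e2]
  field_simp
  ring

/-- Differentiate the implicit equation of the second stage along a line. Division by `p j` in the
derivative of the weight cancels against `g p = p`, so no trace of `p` remains. -/
theorem fderiv_stepMap_apply (hα : Admissible α β) (hM : IsMetzler B) (hC : IsConservative B)
    {p : Fin N → ℝ} (hp : Positive p) (hBp : B *ᵥ p = 0) (h : Fin N → ℝ) :
    fderiv ℝ (stepMap B α β) p h = (1 - α) • h + α • stageMap B β h +
      B *ᵥ ((1 - α * β) • fderiv ℝ (stepMap B α β) p h +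
        (beta20 α β + (1 - α * β) * (sExp α β - 1)) • h +
        (beta21 β - (1 - α * β) * sExp α β) • stageMap B β h) := by
  set k := stageMap B β h with hk
  have hUp : stageMap B β p = p := stageMap_of_mulVec_eq_zero hM hC hα.2.2.1.le hBp
  have hGp := stepMap_of_mulVec_eq_zero hα hM hC hp hBp
  have line : ∀ x : Fin N → ℝ, HasDerivAt (fun t : ℝ => p + t • x) x 0 := fun x => by
    simpa using ((hasDerivAt_id (0 : ℝ)).smul_const x).const_add p
  have hG : HasDerivAt (fun t : ℝ => stepMap B α β (p + t • h)) (fderiv ℝ (stepMap B α β) p h) 0 := by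
    refine HasFDerivAt.comp_hasDerivAt (l := stepMap B α β) 0 ?_ (line h)
    simpa using ((contDiffAt_stepMap hα hM hC hp (n := 1)).differentiableAt one_ne_zero).hasFDerivAt
  have hR := (((line h).const_smul (1 - α)).add ((line k).const_smul α)).add
    ((LinearMap.toContinuousLinearMap B.mulVecLin).hasFDerivAt.comp_hasDerivAt (0 : ℝ)
      ((hasDerivAt_weight α β hp h k).mul hG))
  have hev : (fun t : ℝ => stepMap B α β (p + t • h)) =ᶠ[𝓝 0] fun t : ℝ =>
      (1 - α) • (p + t • h) + α • (p + t • k) +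
        B *ᵥ (weight α β (p + t • h) (p + t • k) * stepMap B α β (p + t • h)) := by
    have hopen : ∀ᶠ t : ℝ in 𝓝 0, Positive (p + t • h) := by
      refine Filter.eventually_all.2 fun i => ?_
      have := ((hasDerivAt_pi.1 (line h)) i).continuousAt.tendsto
      exact this.eventually (lt_mem_nhds (by simpa using hp i))
    filter_upwards [hopen] with t ht
    have := stepMap_eq hα hM hC ht
    rwa [map_add, map_smul, hUp, ← hk] at this
  have key := hG.unique (hR.congr_of_eventuallyEq hev)
  refine key.trans ?_
  congr 1
  change B *ᵥ _ = _
  congr 1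
  ext j
  have := (hp j).ne'
  simp only [zero_smul, add_zero, weight_self α β hp, hGp, Pi.add_apply, Pi.mul_apply,
    Pi.smul_apply, smul_eq_mul]
  field_simp
  ring

theorem resolvent_mul_jacobian (hα : Admissible α β) (hM : IsMetzler B) (hC : IsConservative B)
    {p : Fin N → ℝ} (hp : Positive p) (hBp : B *ᵥ p = 0) :
    (1 - β • B) * (1 - (1 - α * β) • B) * jacobian (stepMap B α β) p =
      1 - ((1 - α) * β) • B - (1 / 2 - α * β + α * β ^ 2) • (B * B) := by
  set J := jacobian (stepMap B α β) p with hJ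
  set V := LinearMap.toMatrix' (stageMap B β : (Fin N → ℝ) →ₗ[ℝ] (Fin N → ℝ)) with hV
  have hJa : ∀ x, J *ᵥ x = fderiv ℝ (stepMap B α β) p x := fun x => by
    rw [hJ, jacobian, LinearMap.toMatrix'_mulVec]; rfl
  have hVa : ∀ x, V *ᵥ x = stageMap B β x := fun x => by
    rw [hV, LinearMap.toMatrix'_mulVec]; rfl
  have h1 : V = 1 + β • (B * V) := by
    refine ext_of_mulVec_single fun i => ?_
    rw [add_mulVec, smul_mulVec, ← mulVec_mulVec, hVa, one_mulVec, ← mulVec_smul]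
    exact stageMap_eq hM hC hα.2.2.1.le _
  set a := beta20 α β + (1 - α * β) * (sExp α β - 1) with ha
  set b := beta21 β - (1 - α * β) * sExp α β with hb
  have h2 : J = (1 - α) • 1 + α • V + B * ((1 - α * β) • J + a • 1 + b • V) := by
    refine ext_of_mulVec_single fun i => ?_
    simp only [add_mulVec, smul_mulVec, ← mulVec_mulVec, hVa, hJa, one_mulVec]
    exact fderiv_stepMap_apply hα hM hC hp hBp _
  have hβ := hα.2.2.1.ne'
  have hc := hα.one_sub_pos.ne'
  have hab : b = - a := by
    rw [ha, hb]; linear_combination beta20_add_beta21 α β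
  -- The only place where the value of the exponent `s` matters; elsewhere it suffices that the two
  -- exponents add up to one.
  have haβ : β * a = 1 / 2 - α * β + α * β ^ 2 := by
    have hcs : (1 - α * β) * sExp α β * β = 1 - α * β + α * β ^ 2 := by
      rw [sExp]; field_simp
    have hb0 : β * beta20 α β = β - 1 / 2 - α * β ^ 2 := by
      rw [beta20]; field_simp
    rw [ha]; linear_combination hcs + hb0
  have h3 : (1 - (1 - α * β) • B) * J = (1 - α) • 1 + α • V + a • B + b • (B * V) := by
    nth_rewrite 1 [sub_mul, one_mul, h2]
    simp only [mul_add, smul_mul_assoc, mul_smul_comm, mul_one]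
    abel
  have h4 : (1 - β • B) * V = 1 := by
    nth_rewrite 1 [sub_mul, one_mul, h1]
    simp only [smul_mul_assoc]
    abel
  have h5 : (1 - β • B) * (B * V) = B := by
    rw [← mul_assoc, sub_mul, one_mul, smul_mul_assoc, ← mul_smul_comm, ← mul_one_sub, mul_assoc,
      h4, mul_one]
  rw [mul_assoc, h3, ← haβ, hab]
  simp only [mul_add, mul_smul_comm, h4, h5, sub_mul, one_mul, smul_mul_assoc, mul_one]
  module

end SSPMPRK

/-! ### Dissipativity and the spectrum of `A` -/

namespace SSPMPRK

variable {N : ℕ} {A B : Matrix (Fin N) (Fin N) ℝ} {α β : ℝ}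

/-- In the variables `x i / y i` this is a Dirichlet form: when the square is expanded, the pure
squares vanish by `A *ᵥ y = 0` and by the zero column sums. -/
theorem two_mul_weighted_form (hC : IsConservative A) {y : Fin N → ℝ} (hy : Positive y)
    (hAy : A *ᵥ y = 0) (x : Fin N → ℝ) :
    2 * ∑ i, x i * (A *ᵥ x) i / y i =
      -∑ i, ∑ j, A i j * y j * (x i / y i - x j / y j) ^ 2 := by
  have h1 : ∑ i, ∑ j, A i j * y j * (x i / y i) ^ 2 = 0 := by
    simp only [← Finset.sum_mul]
    refine Finset.sum_eq_zero fun i _ => ?_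
    have : ∑ j, A i j * y j = 0 := congrFun hAy i
    rw [this, zero_mul]
  have h2 : ∑ i, ∑ j, A i j * y j * (x j / y j) ^ 2 = 0 := by
    rw [Finset.sum_comm]
    simp only [mul_assoc, ← Finset.sum_mul, hC.sum_col, zero_mul, Finset.sum_const_zero]
  have h3 : ∑ i, x i * (A *ᵥ x) i / y i =
      ∑ i, ∑ j, A i j * y j * ((x i / y i) * (x j / y j)) := by
    refine Finset.sum_congr rfl fun i _ => ?_
    rw [mulVec, dotProduct, Finset.mul_sum, Finset.sum_div]
    refine Finset.sum_congr rfl fun j _ => ?_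
    have := (hy i).ne'
    have := (hy j).ne'
    field_simp
  have h4 : ∀ i j, A i j * y j * (x i / y i - x j / y j) ^ 2 = A i j * y j * (x i / y i) ^ 2 +
      A i j * y j * (x j / y j) ^ 2 - 2 * (A i j * y j * ((x i / y i) * (x j / y j))) :=
    fun i j => by ring
  simp only [h4, Finset.sum_sub_distrib, Finset.sum_add_distrib, h1, h2, ← Finset.mul_sum, h3]
  ring

theorem weighted_form_term_nonneg (hM : IsMetzler A) {y : Fin N → ℝ} (hy : Positive y)
    (x : Fin N → ℝ) (i j : Fin N) : 0 ≤ A i j * y j * (x i / y i - x j / y j) ^ 2 := by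
  rcases eq_or_ne i j with rfl | hij
  · simp
  · exact mul_nonneg (mul_nonneg (hM i j hij) (hy j).le) (sq_nonneg _)

/-- A conservative Metzler matrix is dissipative for the inner product weighted with the inverse
of a positive steady state. -/
theorem weighted_form_nonpos (hM : IsMetzler A) (hC : IsConservative A) {y : Fin N → ℝ}
    (hy : Positive y) (hAy : A *ᵥ y = 0) (x : Fin N → ℝ) : ∑ i, x i * (A *ᵥ x) i / y i ≤ 0 := by
  have h1 := two_mul_weighted_form hC hy hAy x
  have h2 : 0 ≤ ∑ i, ∑ j, A i j * y j * (x i / y i - x j / y j) ^ 2 :=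
    Finset.sum_nonneg fun i _ => Finset.sum_nonneg fun j _ => weighted_form_term_nonneg hM hy x i j
  linarith

/-- In the equality case `x i / y i = x j / y j` whenever `A i j ≠ 0`, so row `i` of `A *ᵥ x` is a
multiple of row `i` of `A *ᵥ y = 0`. -/
theorem mulVec_eq_zero_of_weighted_form (hM : IsMetzler A) (hC : IsConservative A)
    {y : Fin N → ℝ} (hy : Positive y) (hAy : A *ᵥ y = 0) {x : Fin N → ℝ}
    (hx : 0 ≤ ∑ i, x i * (A *ᵥ x) i / y i) : A *ᵥ x = 0 := by
  have h1 := two_mul_weighted_form hC hy hAy x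
  have hn := weighted_form_term_nonneg hM hy x
  have h2 : ∑ i, ∑ j, A i j * y j * (x i / y i - x j / y j) ^ 2 = 0 :=
    le_antisymm (by linarith) (Finset.sum_nonneg fun i _ => Finset.sum_nonneg fun j _ => hn i j)
  rw [Finset.sum_eq_zero_iff_of_nonneg fun i _ => Finset.sum_nonneg fun j _ => hn i j] at h2
  ext i
  have h3 := h2 i (Finset.mem_univ i)
  rw [Finset.sum_eq_zero_iff_of_nonneg fun j _ => hn i j] at h3
  have h4 : ∀ j, A i j * x j = A i j * y j * (x i / y i) := fun j => by
    have := (hy j).ne'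
    rcases mul_eq_zero.1 (h3 j (Finset.mem_univ j)) with h | h
    · rcases mul_eq_zero.1 h with h | h
      · simp [h]
      · contradiction
    · rw [sub_eq_zero.1 (pow_eq_zero_iff two_ne_zero |>.1 h)]
      field_simp
  have h5 : ∑ j, A i j * y j = 0 := congrFun hAy i
  simp only [mulVec, dotProduct, h4, ← Finset.sum_mul, h5, zero_mul, Pi.zero_apply]

/-- With `k = A *ᵥ x` in the kernel, the form at `x + t • k` is affine in `t` and bounded above, so
its slope, the weighted square norm of `k`, is zero. -/
theorem mulVec_eq_zero_of_mulVec_mulVec (hM : IsMetzler A) (hC : IsConservative A)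
    {y : Fin N → ℝ} (hy : Positive y) (hAy : A *ᵥ y = 0) {x : Fin N → ℝ}
    (hx : A *ᵥ (A *ᵥ x) = 0) : A *ᵥ x = 0 := by
  set k := A *ᵥ x with hk
  have key : ∀ t : ℝ, ∑ i, x i * k i / y i + t * ∑ i, k i * k i / y i ≤ 0 := fun t => by
    have := weighted_form_nonpos hM hC hy hAy (x + t • k)
    rw [mulVec_add, mulVec_smul, hx, smul_zero, add_zero, ← hk] at this
    refine le_trans (le_of_eq ?_) this
    rw [Finset.mul_sum, ← Finset.sum_add_distrib]
    refine Finset.sum_congr rfl fun i _ => ?_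
    simp only [Pi.add_apply, Pi.smul_apply, smul_eq_mul]
    ring
  have hn : ∀ i, 0 ≤ k i * k i / y i := fun i => div_nonneg (mul_self_nonneg _) (hy i).le
  have hS : ∑ i, k i * k i / y i = 0 := by
    by_contra h
    have h1 := key ((1 - ∑ i, x i * k i / y i) / ∑ i, k i * k i / y i)
    rw [div_mul_cancel₀ _ h] at h1
    linarith
  rw [Finset.sum_eq_zero_iff_of_nonneg fun i _ => hn i] at hS
  ext i
  simpa [(hy i).ne'] using hS i (Finset.mem_univ i)

theorem toComplex_eq_mapMatrix (M : Matrix (Fin N) (Fin N) ℝ) :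
    toComplex M = Complex.ofRealHom.mapMatrix M := rfl

theorem toComplex_smul (r : ℝ) (M : Matrix (Fin N) (Fin N) ℝ) :
    toComplex (r • M) = (r : ℂ) • toComplex M := by
  ext i j; simp [toComplex]

theorem toComplex_mulVec_ofReal (M : Matrix (Fin N) (Fin N) ℝ) (x : Fin N → ℝ) :
    toComplex M *ᵥ (fun i => (x i : ℂ)) = fun i => (((M *ᵥ x) i : ℝ) : ℂ) := by
  ext i; simp [toComplex, mulVec, dotProduct]

theorem re_toComplex_mulVec (M : Matrix (Fin N) (Fin N) ℝ) (v : Fin N → ℂ) (i : Fin N) :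
    ((toComplex M *ᵥ v) i).re = (M *ᵥ fun j => (v j).re) i := by
  simp [toComplex, mulVec, dotProduct]

theorem im_toComplex_mulVec (M : Matrix (Fin N) (Fin N) ℝ) (v : Fin N → ℂ) (i : Fin N) :
    ((toComplex M *ᵥ v) i).im = (M *ᵥ fun j => (v j).im) i := by
  simp [toComplex, mulVec, dotProduct]

/-- The forms of the real and imaginary parts of `v` add up to `μ.re` times a weighted square norm.
If `μ.re ≥ 0`, both are in the equality case and `v` lies in the kernel; this also excludes
imaginary eigenvalues. -/
theorem re_neg_of_mulVec_eq_smul (hM : IsMetzler A) (hC : IsConservative A)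
    {y : Fin N → ℝ} (hy : Positive y) (hAy : A *ᵥ y = 0) {μ : ℂ} {v : Fin N → ℂ} (hv : v ≠ 0)
    (hμ : μ ≠ 0) (h : toComplex A *ᵥ v = μ • v) : μ.re < 0 := by
  by_contra! hre
  have ha : ∀ i, (A *ᵥ fun j => (v j).re) i = μ.re * (v i).re - μ.im * (v i).im := fun i => by
    rw [← re_toComplex_mulVec, h]; simp
  have hb : ∀ i, (A *ᵥ fun j => (v j).im) i = μ.re * (v i).im + μ.im * (v i).re := fun i => by
    rw [← im_toComplex_mulVec, h]; simp
  have hsum : 0 ≤ (∑ i, (v i).re * (A *ᵥ fun j => (v j).re) i / y i) +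
      ∑ i, (v i).im * (A *ᵥ fun j => (v j).im) i / y i := by
    rw [← Finset.sum_add_distrib]
    refine Finset.sum_nonneg fun i _ => ?_
    rw [ha, hb, ← add_div]
    refine div_nonneg ?_ (hy i).le
    have : 0 ≤ μ.re * ((v i).re ^ 2 + (v i).im ^ 2) := by positivity
    linarith
  have h1 := weighted_form_nonpos hM hC hy hAy fun j => (v j).re
  have h2 := weighted_form_nonpos hM hC hy hAy fun j => (v j).im
  have h3 := mulVec_eq_zero_of_weighted_form hM hC hy hAy (x := fun j => (v j).re) (by linarith)
  have h4 := mulVec_eq_zero_of_weighted_form hM hC hy hAy (x := fun j => (v j).im) (by linarith)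
  have h5 : μ • v = 0 := by
    rw [← h]
    ext i
    exact Complex.ext (by rw [re_toComplex_mulVec, h3]; rfl) (by rw [im_toComplex_mulVec, h4]; rfl)
  exact (smul_eq_zero.1 h5).elim hμ hv

/-- A square matrix with semisimple eigenvalue zero has a commuting generalized inverse. -/
theorem exists_group_inverse (hA : ∀ x, A *ᵥ (A *ᵥ x) = 0 → A *ᵥ x = 0) :
    ∃ X : Matrix (Fin N) (Fin N) ℝ, A * X * A = A ∧ ∀ M, Commute M A → Commute M X := by
  -- Write the characteristic polynomial as `X ^ k * q` with `q` nonzero at 0. By Cayley-Hamilton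
  -- and semisimplicity `A * q(A) = 0`; solving this for the constant term of `q` yields the inverse
  -- as a polynomial in `A`.
  obtain ⟨q, hq, hnd⟩ :=
    A.charpoly.exists_eq_pow_rootMultiplicity_mul_and_not_dvd A.charpoly_monic.ne_zero 0
  generalize A.charpoly.rootMultiplicity 0 = k at hq
  rw [Polynomial.C_0, sub_zero] at hq hnd
  have h0 : A ^ k * Polynomial.aeval A q = 0 := by
    have := A.aeval_self_charpoly
    rwa [hq, map_mul, map_pow, Polynomial.aeval_X] at this
  have hmat : ∀ M : Matrix (Fin N) (Fin N) ℝ, A * (A * M) = 0 → A * M = 0 := fun M hMz => by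
    refine ext_of_mulVec_single fun i => ?_
    rw [← mulVec_mulVec, zero_mulVec]
    exact hA _ (by rw [mulVec_mulVec, mulVec_mulVec, mul_assoc, hMz, zero_mulVec])
  have hpow : ∀ (k : ℕ) (M : Matrix (Fin N) (Fin N) ℝ), A ^ k * M = 0 → A * M = 0 := by
    intro k
    induction k with
    | zero => intro M hMz; rw [pow_zero, one_mul] at hMz; rw [hMz, mul_zero]
    | succ k ih => intro M hMz; exact hmat M (ih _ (by rw [← mul_assoc, ← pow_succ, hMz]))
  have h1 := hpow k _ h0
  have hc : q.coeff 0 ≠ 0 := fun h => hnd (Polynomial.X_dvd_iff.2 h)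
  refine ⟨-(q.coeff 0)⁻¹ • Polynomial.aeval A q.divX, ?_, fun M hMA => ?_⟩
  · have h2 := congrArg (Polynomial.aeval A) q.divX_mul_X_add
    rw [map_add, map_mul, Polynomial.aeval_X, Polynomial.aeval_C] at h2
    rw [← h2, mul_add, Algebra.algebraMap_eq_smul_one, mul_smul_comm, mul_one] at h1
    rw [mul_smul_comm, smul_mul_assoc, mul_assoc, eq_neg_of_add_eq_zero_left h1, neg_smul, smul_neg, neg_neg,
      smul_smul, inv_mul_cancel₀ hc, one_smul]
  · refine Commute.smul_right ?_ _
    induction q.divX using Polynomial.induction_on' with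
    | add p q hp hq => rw [map_add]; exact hp.add_right hq
    | monomial n a =>
      rw [Polynomial.aeval_monomial]
      exact Commute.mul_right (Algebra.commutes a M).symm (hMA.pow_right n)

theorem isUnit_one_sub_smul (hM : IsMetzler B) (hC : IsConservative B) {γ : ℝ} (hγ : 0 ≤ γ) :
    IsUnit (1 - γ • B) := by
  rw [← mulVec_injective_iff_isUnit]
  refine (injective_iff_map_eq_zero (1 - γ • B).mulVecLin).2 fun x hx => ?_
  refine eq_zero_of_eq_mulVec hM hC (w := fun _ => γ) (fun _ => hγ) ?_
  have e : (fun _ => γ) * x = γ • x := by ext; simp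
  rw [mulVecLin_apply, sub_mulVec, one_mulVec, smul_mulVec, sub_eq_zero] at hx
  rwa [e, mulVec_smul]

theorem toComplex_jacobian_mulVec {J : Matrix (Fin N) (Fin N) ℝ}
    (hJ : (1 - β • B) * (1 - (1 - α * β) • B) * J =
      1 - ((1 - α) * β) • B - (1 / 2 - α * β + α * β ^ 2) • (B * B))
    (h1 : IsUnit (1 - β • B)) (h2 : IsUnit (1 - (1 - α * β) • B)) {z : ℂ} {v : Fin N → ℂ}
    (hv : toComplex B *ᵥ v = z • v) : toComplex J *ᵥ v = stabFun α β z • v := by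
  rcases eq_or_ne v 0 with rfl | hv0
  · simp
  have hF := (h1.mul h2).map (Complex.ofRealHom.mapMatrix (m := Fin N))
  rw [← toComplex_eq_mapMatrix, ← mulVec_injective_iff_isUnit] at hF
  set F := toComplex ((1 - β • B) * (1 - (1 - α * β) • B)) with hFdef
  have hlin : ∀ γ : ℝ, toComplex (1 - γ • B) *ᵥ v = (1 - γ * z) • v := fun γ => by
    rw [toComplex_eq_mapMatrix, map_sub, map_one, ← toComplex_eq_mapMatrix, toComplex_smul,
      sub_mulVec, one_mulVec, smul_mulVec, hv]
    module
  have hFv : F *ᵥ v = ((1 - (1 - α * β : ℝ) * z) * (1 - β * z)) • v := by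
    rw [hFdef, toComplex_eq_mapMatrix, map_mul, ← toComplex_eq_mapMatrix, ← toComplex_eq_mapMatrix,
      ← mulVec_mulVec, hlin, mulVec_smul, hlin, smul_smul]
  have hne : (1 - (1 - α * β : ℝ) * z) * (1 - β * z) ≠ 0 := fun h => by
    rw [h, zero_smul] at hFv
    exact hv0 (hF (by rw [hFv, mulVec_zero]))
  have hFJ : F *ᵥ (toComplex J *ᵥ v) =
      (1 - (1 - α) * β * z - (1 / 2 - α * β + α * β ^ 2) * (z * z)) • v := by
    rw [mulVec_mulVec, hFdef, toComplex_eq_mapMatrix, toComplex_eq_mapMatrix, ← map_mul, hJ,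
      map_sub, map_sub, map_one, ← toComplex_eq_mapMatrix, ← toComplex_eq_mapMatrix,
      toComplex_smul, toComplex_smul, toComplex_eq_mapMatrix (B * B), map_mul,
      ← toComplex_eq_mapMatrix, sub_mulVec, sub_mulVec, one_mulVec, smul_mulVec, smul_mulVec,
      ← mulVec_mulVec, hv, mulVec_smul, hv]
    push_cast
    module
  refine hF ?_
  rw [hFJ, mulVec_smul, hFv, smul_smul]
  congr 1
  have hne' : (2 : ℂ) * (1 + (α * β - 1) * z) * (β * z - 1) ≠ 0 := by
    intro h
    apply hne
    push_cast
    linear_combination -(1 / 2 : ℂ) * h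
  rw [stabFun, div_mul_eq_mul_div, eq_div_iff hne']
  push_cast
  ring

end SSPMPRK

/-! ### Size of the stability function -/

namespace SSPMPRK

variable {α β : ℝ}

theorem norm_stabFun_lt_one (h : Admissible α β) (hle : α ≤ 1 / (2 * β)) {z : ℂ}
    (hz : z.re < 0) : ‖stabFun α β z‖ < 1 := by
  have hβ := h.2.2.1
  have hα := h.1
  have hα1 := h.2.1
  have hc := h.one_sub_pos
  have hh := h.half_le
  have hab : α * β ≤ 1 / 2 := by
    rw [le_div_iff₀ (by positivity)] at hle; linarith
  set n : ℂ := -2 + (2 * α * β ^ 2 - 2 * α * β + 1) * z ^ 2 - 2 * β * (α - 1) * z with hn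
  set d : ℂ := 2 * (1 + (α * β - 1) * z) * (β * z - 1) with hd
  obtain ⟨x, y⟩ := z
  simp only at hz
  have hns : Complex.normSq n = (-2 + (2 * α * β ^ 2 - 2 * α * β + 1) * (x ^ 2 - y ^ 2) -
      2 * β * (α - 1) * x) ^ 2 +
      ((2 * α * β ^ 2 - 2 * α * β + 1) * (2 * x * y) - 2 * β * (α - 1) * y) ^ 2 := by
    rw [Complex.normSq_apply, hn]
    simp [pow_two]
    ring
  have hds : Complex.normSq d = 4 * ((1 + (α * β - 1) * x) ^ 2 + ((α * β - 1) * y) ^ 2) *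
      ((β * x - 1) ^ 2 + (β * y) ^ 2) := by
    rw [hd, map_mul, map_mul, Complex.normSq_apply, Complex.normSq_apply, Complex.normSq_apply]
    simp
    ring
  -- For `x < 0` the term `-8 * x` is strictly positive and the others are nonnegative; the quartic
  -- one has the sign of `(1 - 2αβ)(2β - 1)`.
  have key : Complex.normSq d - Complex.normSq n = -8 * x +
      ((1 - 2 * (α * β)) * (2 * β - 1)) * (2 * β * (1 - α) + 1) * (x ^ 2 + y ^ 2) ^ 2 +
      8 * (2 * β * (1 - α) + 1) * x ^ 2 + 2 * (-x) * (x ^ 2 + y ^ 2) *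
      (4 * ((1 - α * β) + β) * (1 - α * β) * β + 2 * (1 - α) * β *
        (2 * α * β ^ 2 - 2 * α * β + 1)) := by
    rw [hns, hds]; ring
  have hlt : Complex.normSq n < Complex.normSq d := by
    have t1 : 0 ≤ ((1 - 2 * (α * β)) * (2 * β - 1)) * (2 * β * (1 - α) + 1) *
        (x ^ 2 + y ^ 2) ^ 2 := by
      have : 0 ≤ 1 - 2 * (α * β) := by linarith
      have : 0 ≤ 2 * β - 1 := by linarith
      have : 0 ≤ 1 - α := by linarith
      positivity
    have t2 : 0 ≤ 8 * (2 * β * (1 - α) + 1) * x ^ 2 := by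
      have : 0 ≤ 1 - α := by linarith
      positivity
    have t3 : 0 ≤ 2 * (-x) * (x ^ 2 + y ^ 2) *
      (4 * ((1 - α * β) + β) * (1 - α * β) * β + 2 * (1 - α) * β *
        (2 * α * β ^ 2 - 2 * α * β + 1)) := by
      have : 0 ≤ 1 - α := by linarith
      have : 0 ≤ 2 * α * β ^ 2 - 2 * α * β + 1 := by
        have : 0 ≤ α * β ^ 2 := by positivity
        linarith
      have : 0 < -x := by linarith
      positivity
    linarith
  have hd0 : 0 < ‖d‖ := by
    rw [norm_pos_iff, ← Complex.normSq_pos]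
    exact (Complex.normSq_nonneg n).trans_lt hlt
  rw [stabFun, norm_div, div_lt_one hd0]
  rw [Complex.normSq_eq_norm_sq, Complex.normSq_eq_norm_sq] at hlt
  exact lt_of_pow_lt_pow_left₀ 2 hd0.le hlt

theorem isBounded_stabRegion (h : Admissible α β) (hlt : 1 / (2 * β) < α) :
    Bornology.IsBounded (stabRegion α β) := by
  have hβ := h.2.2.1
  have hα := h.1
  have hα1 := h.2.1
  have hc := h.one_sub_pos
  have hab : 1 < 2 * (α * β) := by
    rw [div_lt_iff₀ (by positivity)] at hlt; linarith
  have hβ2 : 1 < 2 * β := by nlinarith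
  set e := 2 * α * β ^ 2 - 2 * α * β + 1 with he
  set f := 2 * (1 - α * β) * β with hf
  have hef : 0 < e - f := by
    rw [show e - f = (2 * (α * β) - 1) * (2 * β - 1) by rw [he, hf]; ring]
    exact mul_pos (by linarith) (by linarith)
  have hf0 : 0 < f := by positivity
  set K := 2 * β * (1 - α) + 2 * (1 - α * β + β) with hK
  have hK0 : 0 ≤ K := by
    have : 0 ≤ 1 - α := by linarith
    positivity
  rw [isBounded_iff_forall_norm_le]
  -- `e` and `f` are the moduli of the leading coefficients, and `|R| ≤ 1` forces `(e - f) * r ^ 2 ≤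
  -- K * r + 4`. This fails once `r > 1` and `(e - f) * r > K + 4`.
  refine ⟨max 1 ((K + 4) / (e - f)), fun z ⟨hz, hR⟩ => ?_⟩
  by_contra! hbig
  obtain ⟨hr1, hr2⟩ := max_lt_iff.1 hbig
  rw [div_lt_iff₀ hef] at hr2
  have hden : 2 * (1 + (α * β - 1) * z) * (β * z - 1) ≠ 0 := by
    refine mul_ne_zero (mul_ne_zero two_ne_zero fun h0 => ?_) fun h0 => ?_
    · have := congrArg Complex.re h0
      simp at this
      nlinarith
    · have := congrArg Complex.re h0
      simp at this
      nlinarith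
  rw [stabFun, norm_div, div_le_one (norm_pos_iff.2 hden)] at hR
  set r := ‖z‖ with hr
  have hnum : e * r ^ 2 - 2 * β * (1 - α) * r - 2 ≤
      ‖-2 + (2 * α * β ^ 2 - 2 * α * β + 1) * z ^ 2 - 2 * β * (α - 1) * z‖ := by
    have h1 : ‖(e : ℂ) * z ^ 2‖ = e * r ^ 2 := by
      rw [norm_mul, norm_pow, Complex.norm_real, Real.norm_of_nonneg (by linarith)]
    have h2 : ‖((2 * β * (1 - α) : ℝ) : ℂ) * z‖ = 2 * β * (1 - α) * r := by
      rw [norm_mul, Complex.norm_real, Real.norm_of_nonneg (mul_nonneg (by linarith) (by linarith))]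
    have h3 : (e : ℂ) * z ^ 2 =
        (-2 + (2 * α * β ^ 2 - 2 * α * β + 1) * z ^ 2 - 2 * β * (α - 1) * z) -
          ((2 * β * (1 - α) : ℝ) : ℂ) * z + 2 := by
      rw [he]; push_cast; ring
    have h4 := (norm_add_le _ _).trans (add_le_add_left (norm_sub_le
      (-2 + (2 * α * β ^ 2 - 2 * α * β + 1) * z ^ 2 - 2 * β * (α - 1) * z)
      (((2 * β * (1 - α) : ℝ) : ℂ) * z)) ‖(2 : ℂ)‖)
    rw [← h3, h1, h2, Complex.norm_ofNat] at h4
    linarith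
  have hdenle : ‖2 * (1 + (α * β - 1) * z) * (β * z - 1)‖ ≤
      f * r ^ 2 + 2 * (1 - α * β + β) * r + 2 := by
    have h1 : ‖1 + ((α : ℂ) * β - 1) * z‖ ≤ 1 + (1 - α * β) * r := by
      have e1 : ‖((α : ℂ) * β - 1)‖ = 1 - α * β := by
        rw [norm_sub_rev, ← Complex.ofReal_mul, ← Complex.ofReal_one, ← Complex.ofReal_sub,
          Complex.norm_real, Real.norm_of_nonneg hc.le]
      refine (norm_add_le _ _).trans ?_
      rw [norm_one, norm_mul, e1]
    have h2 : ‖(β : ℂ) * z - 1‖ ≤ β * r + 1 := by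
      refine (norm_sub_le _ _).trans ?_
      rw [norm_one, norm_mul, Complex.norm_real, Real.norm_of_nonneg hβ.le]
    rw [norm_mul, norm_mul, Complex.norm_ofNat]
    calc 2 * ‖1 + ((α : ℂ) * β - 1) * z‖ * ‖(β : ℂ) * z - 1‖
        ≤ 2 * (1 + (1 - α * β) * r) * (β * r + 1) := by gcongr
      _ = _ := by rw [hf]; ring
  nlinarith [mul_lt_mul_of_pos_right hr2 (by linarith : 0 < r)]

end SSPMPRK

/-! ### Contraction from the spectral radius -/

section

open scoped Matrix.Norms.Operator

/-- Gelfand's formula: the spectral radius is below some `r < 1`, so the norms of large powers are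
at most `r ^ m`. -/
theorem Matrix.exists_norm_pow_le_half {N : ℕ} (M : Matrix (Fin N) (Fin N) ℂ)
    (hM : ∀ (μ : ℂ) (v : Fin N → ℂ), v ≠ 0 → M *ᵥ v = μ • v → ‖μ‖ < 1) :
    ∃ m, 0 < m ∧ ‖M ^ m‖ ≤ 1 / 2 := by
  rcases subsingleton_or_nontrivial (Matrix (Fin N) (Fin N) ℂ) with hs | hn
  · exact ⟨1, one_pos, by rw [Subsingleton.elim (M ^ 1) 0, norm_zero]; norm_num⟩
  have hρ : spectralRadius ℂ M < (1 : NNReal) := by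
    refine spectrum.spectralRadius_lt_of_forall_lt M fun μ hμ => ?_
    rw [← spectrum_toLin', ← Module.End.hasEigenvalue_iff_mem_spectrum] at hμ
    obtain ⟨v, hv⟩ := hμ.exists_hasEigenvector
    exact hM μ v hv.2 (by simpa using hv.apply_eq_smul)
  obtain ⟨r, hr1, hr2⟩ := ENNReal.lt_iff_exists_nnreal_btwn.1 hρ
  have hr2' : (r : ℝ) < 1 := by exact_mod_cast hr2
  have hG := (spectrum.pow_norm_pow_one_div_tendsto_nhds_spectralRadius M).eventually_lt_const hr1
  have hp := (tendsto_pow_atTop_nhds_zero_of_lt_one r.2 hr2').eventually_le_const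
    (by norm_num : (0 : ℝ) < 1 / 2)
  obtain ⟨m, ⟨h1, h2⟩, hm⟩ := ((hG.and hp).and (Filter.eventually_gt_atTop 0)).exists
  refine ⟨m, hm, le_trans ?_ h2⟩
  have h3 : ‖M ^ m‖ ^ (1 / m : ℝ) < r := by
    rw [← ENNReal.ofReal_coe_nnreal] at h1
    exact (ENNReal.ofReal_lt_ofReal_iff'.1 h1).1
  calc ‖M ^ m‖ = (‖M ^ m‖ ^ (1 / m : ℝ)) ^ m := by
        rw [one_div, Real.rpow_inv_natCast_pow (norm_nonneg _) hm.ne']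
    _ ≤ r ^ m := by gcongr

namespace SSPMPRK

/-- A power of `M` is a contraction in the maximum norm if all complex eigenvalues of `M` lie in
the open unit disc. -/
theorem exists_norm_pow_mulVec_le {N : ℕ} (M : Matrix (Fin N) (Fin N) ℝ)
    (hM : ∀ (μ : ℂ) (v : Fin N → ℂ), v ≠ 0 → toComplex M *ᵥ v = μ • v → ‖μ‖ < 1) :
    ∃ m, 0 < m ∧ ∀ x, ‖M ^ m *ᵥ x‖ ≤ 1 / 2 * ‖x‖ := by
  obtain ⟨m, hm, hle⟩ := (toComplex M).exists_norm_pow_le_half hM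
  refine ⟨m, hm, fun x => ?_⟩
  have hnorm : ∀ x : Fin N → ℝ, ‖fun i => (x i : ℂ)‖ = ‖x‖ := fun x => by
    simp [Pi.norm_def]
  have h1 : toComplex M ^ m = toComplex (M ^ m) := by
    rw [toComplex_eq_mapMatrix, toComplex_eq_mapMatrix, map_pow]
  rw [h1] at hle
  have h2 := linfty_opNorm_mulVec (toComplex (M ^ m)) fun i => (x i : ℂ)
  rw [toComplex_mulVec_ofReal, hnorm, hnorm] at h2
  exact h2.trans (by gcongr)

end SSPMPRK

end

/-! ### Assembling the stability proof -/

namespace SSPMPRK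

variable {N : ℕ} {A : Matrix (Fin N) (Fin N) ℝ}

theorem jacobian_mulVec {g : (Fin N → ℝ) → (Fin N → ℝ)} (y x : Fin N → ℝ) :
    jacobian g y *ᵥ x = fderiv ℝ g y x := by
  rw [jacobian, LinearMap.toMatrix'_mulVec]; rfl

theorem commute_of_mul_left {B D J n : Matrix (Fin N) (Fin N) ℝ} (hD : IsUnit D)
    (hDB : Commute D B) (hn : Commute n B) (h : D * J = n) : Commute J B := by
  refine hD.mul_left_cancel ?_
  rw [← mul_assoc, h, hn.eq, ← h, ← mul_assoc, ← mul_assoc, hDB.eq]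

/-- If `J` commutes with `A` and its eigenvalues belonging to nonzero eigenvalues of `A` lie in
the open unit disc, a power of `J` is a contraction on the range of `A`. -/
theorem exists_contraction_on_range {J X : Matrix (Fin N) (Fin N) ℝ} (hJA : Commute J A)
    (hXA : Commute X A) (hJX : Commute J X) (hAXA : A * X * A = A)
    (hJ : ∀ (μ : ℂ) (v : Fin N → ℂ), μ ≠ 0 → v ≠ 0 → toComplex A *ᵥ v = μ • v →
      ∃ ν : ℂ, ‖ν‖ < 1 ∧ toComplex J *ᵥ v = ν • v) :
    ∃ m, 0 < m ∧ ∀ x, ‖J ^ m *ᵥ (A * X) *ᵥ x‖ ≤ 1 / 2 * ‖(A * X) *ᵥ x‖ := by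
  have hQ : A * X * (A * X) = A * X := by rw [← mul_assoc, hAXA]
  have hJQ : Commute J (A * X) := hJA.mul_right hJX
  have hQA : Commute (A * X) A := (Commute.refl A).mul_left hXA
  have hcomm : Commute (J * (A * X)) A := hJA.mul_left hQA
  -- `J * (A * X)` vanishes on `ker A`, so only its nonzero eigenvalues matter. `A` preserves each
  -- eigenspace and has an eigenvector `w` there; its eigenvalue is nonzero, hence `A * X` fixes `w`
  -- and `μ` is an eigenvalue of `J` covered by `hJ`.
  obtain ⟨m, hm, hle⟩ := exists_norm_pow_mulVec_le (J * (A * X)) fun μ v hv hμv => by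
    rcases eq_or_ne μ 0 with rfl | hμ
    · simp
    set f : Module.End ℂ (Fin N → ℂ) := toLin' (toComplex (J * (A * X))) with hf
    set a : Module.End ℂ (Fin N → ℂ) := toLin' (toComplex A) with ha
    have hcf : Commute a f := by
      have h1 : Commute (toComplex A) (toComplex (J * (A * X))) :=
        hcomm.symm.map Complex.ofRealHom.mapMatrix
      change a * f = f * a
      rw [Module.End.mul_eq_comp, Module.End.mul_eq_comp, ← toLin'_mul, ← toLin'_mul, h1.eq]
    have hmaps : ∀ w ∈ f.eigenspace μ, a w ∈ f.eigenspace μ := fun w hw => by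
      rw [Module.End.mem_eigenspace_iff] at hw ⊢
      rw [← Module.End.mul_apply, ← hcf.eq, Module.End.mul_apply, hw, map_smul]
    have hvmem : v ∈ f.eigenspace μ := by
      rw [Module.End.mem_eigenspace_iff, hf, toLin'_apply, hμv]
    have : Nontrivial (f.eigenspace μ) := ⟨⟨v, hvmem⟩, 0, fun h => hv (congrArg Subtype.val h)⟩
    obtain ⟨l, hl⟩ := Module.End.exists_eigenvalue (a.restrict hmaps)
    obtain ⟨w, hw⟩ := hl.exists_hasEigenvector
    have hw0 : (w : Fin N → ℂ) ≠ 0 := fun h => hw.2 (Subtype.ext h)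
    have hAw : toComplex A *ᵥ (w : Fin N → ℂ) = l • (w : Fin N → ℂ) :=
      congrArg Subtype.val hw.apply_eq_smul
    have hfw : toComplex (J * (A * X)) *ᵥ (w : Fin N → ℂ) = μ • (w : Fin N → ℂ) :=
      Module.End.mem_eigenspace_iff.1 w.2
    have hl0 : l ≠ 0 := by
      rintro rfl
      rw [← hXA.eq, toComplex_eq_mapMatrix, map_mul, map_mul, ← mulVec_mulVec, ← mulVec_mulVec,
        ← toComplex_eq_mapMatrix A, hAw, zero_smul, mulVec_zero, mulVec_zero] at hfw
      exact (smul_ne_zero hμ hw0) hfw.symm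
    have hQw : toComplex (A * X) *ᵥ (w : Fin N → ℂ) = w := by
      have h1 : toComplex (A * X) *ᵥ (toComplex A *ᵥ (w : Fin N → ℂ)) = toComplex A *ᵥ w := by
        rw [mulVec_mulVec, toComplex_eq_mapMatrix, toComplex_eq_mapMatrix, ← map_mul, hAXA]
      rw [hAw, mulVec_smul] at h1
      exact smul_right_injective _ hl0 h1
    obtain ⟨ν, hν, hJw⟩ := hJ l w hl0 hw0 hAw
    rw [toComplex_eq_mapMatrix, map_mul, ← mulVec_mulVec, ← toComplex_eq_mapMatrix,
      ← toComplex_eq_mapMatrix, hQw, hJw] at hfw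
    rwa [← smul_left_injective ℂ hw0 hfw]
  refine ⟨m, hm, fun x => ?_⟩
  have hpow : (J * (A * X)) ^ m = J ^ m * (A * X) := by
    rw [hJQ.mul_pow, (show IsIdempotentElem (A * X) from hQ).pow_eq hm.ne']
  have := hle ((A * X) *ᵥ x)
  rwa [hpow, mulVec_mulVec, mul_assoc, hQ, ← mulVec_mulVec] at this

theorem IsSchemeMap.lyapunovStable {α β : ℝ} (h : Admissible α β) (hle : α ≤ 1 / (2 * β))
    (hM : IsMetzler A) (hC : IsConservative A) {p : Fin N → ℝ} (hp : Positive p)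
    (hAp : A *ᵥ p = 0) {τ : ℝ} (hτ : 0 < τ) {g : (Fin N → ℝ) → (Fin N → ℝ)}
    (hg : IsSchemeMap (linProd A) (linDest A) α β τ g)
    (hgd : HasStrictFDerivAt g (fderiv ℝ g p) p)
    (hD : {y : Fin N → ℝ | Positive y} ∈ 𝓝 p)
    (hJA : Commute (jacobian g p) A)
    (hJ : ∀ (μ : ℂ) (v : Fin N → ℂ), toComplex A *ᵥ v = μ • v →
      toComplex (jacobian g p) *ᵥ v = stabFun α β (τ * μ) • v) :
    LyapunovStable {y | Positive y} g p := by
  obtain ⟨X, hAXA, hX⟩ := exists_group_inverse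
    fun x => mulVec_eq_zero_of_mulVec_mulVec hM hC hp hAp (x := x)
  have hXA : Commute X A := (hX A (Commute.refl A)).symm
  have hB : ∀ y, A *ᵥ y = 0 → (τ • A) *ᵥ y = 0 := fun y hy => by rw [smul_mulVec, hy, smul_zero]
  obtain ⟨m, hm, hcon⟩ := exists_contraction_on_range hJA hXA (hX _ hJA) hAXA
    fun μ v hμ hv hAv => ⟨_, norm_stabFun_lt_one h hle (by
      rw [Complex.re_ofReal_mul]
      exact mul_neg_of_pos_of_neg hτ (re_neg_of_mulVec_eq_smul hM hC hp hAp hv hμ hAv)), hJ μ v hAv⟩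
  set P := LinearMap.toContinuousLinearMap (1 - A * X).mulVecLin with hP
  have hPa : ∀ x, P x = (1 - A * X) *ᵥ x := fun x => rfl
  have hAP : ∀ x, A *ᵥ P x = 0 := fun x => by
    rw [hPa, mulVec_mulVec, mul_sub, mul_one, ← hXA.eq, ← mul_assoc, hAXA, sub_self, zero_mulVec]
  have hPA : (1 - A * X) * (τ • A) = 0 := by
    rw [mul_smul_comm, sub_mul, one_mul, hAXA, sub_self, smul_zero]
  have hLm : ∀ x, (fderiv ℝ g p ^ m) x = jacobian g p ^ m *ᵥ x := fun x => by
    clear hcon hm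
    induction m with
    | zero => simp
    | succ m ih =>
      rw [pow_succ', pow_succ', ← mulVec_mulVec, ← ih, jacobian_mulVec]
      rfl
  refine stable_of_hasStrictFDerivAt (P := P) hD (fun y hy => (hg y hy).1) hgd ?_ ?_ ?_ ?_ ?_
  · rw [hg.eq_stepMap h hM hC hτ hp]
    exact stepMap_of_mulVec_eq_zero h (hM.smul hτ.le) (hC.smul τ) hp (hB p hAp)
  · rw [hPa, ← hXA.eq, sub_mulVec, one_mulVec, ← mulVec_mulVec, hAp, mulVec_zero, sub_zero]
  · intro y hy
    rw [hg.eq_stepMap h hM hC hτ hy, hPa, hPa]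
    exact mulVec_stepMap h (hM.smul hτ.le) (hC.smul τ) hPA hy
  · intro y _ hPy
    rw [hg.eq_stepMap h hM hC hτ hPy]
    exact stepMap_of_mulVec_eq_zero h (hM.smul hτ.le) (hC.smul τ) hPy (hB _ (hAP y))
  · refine ⟨m, hm, fun x => ?_⟩
    have : x - P x = (A * X) *ᵥ x := by rw [hPa, sub_mulVec, one_mulVec, sub_sub_cancel]
    rw [this, hLm]
    exact hcon x

end SSPMPRK

theorem mainTheorem2 (α β : ℝ) (hαβ : SSPMPRK.Admissible α β)
    (N : ℕ) (A : Matrix (Fin N) (Fin N) ℝ)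
    (hMetzler : SSPMPRK.IsMetzler A) (hCons : SSPMPRK.IsConservative A)
    (ystar : Fin N → ℝ) (hpos : SSPMPRK.Positive ystar) (hsteady : Matrix.mulVec A ystar = 0) :
    -- boundedness of the stability region
    (1 / (2 * β) < α → Bornology.IsBounded (SSPMPRK.stabRegion α β)) ∧
    ∀ Δt : ℝ, 0 < Δt →
      -- the scheme defines a map of the positive orthant to itself
      (∃ g, SSPMPRK.IsSchemeMap (SSPMPRK.linProd A) (SSPMPRK.linDest A) α β Δt g) ∧
      ∀ g, SSPMPRK.IsSchemeMap (SSPMPRK.linProd A) (SSPMPRK.linDest A) α β Δt g →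
        g ystar = ystar ∧
        -- `stabFun` is the stability function of the scheme
        (DifferentiableAt ℝ g ystar ∧
          ∀ (μ : ℂ) (v : Fin N → ℂ),
            Matrix.mulVec (SSPMPRK.toComplex A) v = μ • v →
            Matrix.mulVec (SSPMPRK.toComplex (SSPMPRK.jacobian g ystar)) v =
              SSPMPRK.stabFun α β (Δt * μ) • v) ∧
        (α < 1 / (2 * β) → (α, β) ≠ (0, 1 / 2) →
          SSPMPRK.LyapunovStable {y | SSPMPRK.Positive y} g ystar) ∧
        ((α = 1 / (2 * β) ∨ (α, β) = (0, 1 / 2)) →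
          (∀ μ : ℂ, SSPMPRK.IsEigenvalue A μ → μ ≠ 0 → μ.re < 0) →
          SSPMPRK.LyapunovStable {y | SSPMPRK.Positive y} g ystar) := by
  refine ⟨SSPMPRK.isBounded_stabRegion hαβ, fun Δt hΔt =>
    ⟨⟨_, SSPMPRK.isSchemeMap_stepMap hαβ hMetzler hCons hΔt⟩, fun g hg => ?_⟩⟩
  have hM := hMetzler.smul hΔt.le
  have hC := hCons.smul Δt
  have hB : (Δt • A) *ᵥ ystar = 0 := by rw [smul_mulVec, hsteady, smul_zero]
  have hD : {y : Fin N → ℝ | SSPMPRK.Positive y} ∈ 𝓝 ystar :=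
    Filter.eventually_all.2 fun i => (continuous_apply i).continuousAt.eventually (lt_mem_nhds (hpos i))
  have hev : SSPMPRK.stepMap (Δt • A) α β =ᶠ[𝓝 ystar] g :=
    Filter.mem_of_superset hD fun y hy => (hg.eq_stepMap hαβ hMetzler hCons hΔt hy).symm
  have hgd : HasStrictFDerivAt g (fderiv ℝ g ystar) ystar := by
    rw [← hev.fderiv_eq]
    exact ((SSPMPRK.contDiffAt_stepMap hαβ hM hC hpos (n := 1)).hasStrictFDerivAt
      one_ne_zero).congr_of_eventuallyEq hev
  have hjac : SSPMPRK.jacobian g ystar = SSPMPRK.jacobian (SSPMPRK.stepMap (Δt • A) α β) ystar := by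
    rw [SSPMPRK.jacobian, SSPMPRK.jacobian, hev.fderiv_eq]
  have hid := SSPMPRK.resolvent_mul_jacobian hαβ hM hC hpos hB
  rw [← hjac] at hid
  have hu1 := SSPMPRK.isUnit_one_sub_smul hM hC hαβ.2.2.1.le
  have hu2 := SSPMPRK.isUnit_one_sub_smul hM hC hαβ.one_sub_pos.le
  have hJ : ∀ (μ : ℂ) (v : Fin N → ℂ), SSPMPRK.toComplex A *ᵥ v = μ • v →
      SSPMPRK.toComplex (SSPMPRK.jacobian g ystar) *ᵥ v =
        SSPMPRK.stabFun α β (Δt * μ) • v := fun μ v hv =>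
    SSPMPRK.toComplex_jacobian_mulVec hid hu1 hu2
      (by rw [SSPMPRK.toComplex_smul, smul_mulVec, hv, smul_smul])
  have hBA : Commute (Δt • A) A := (Commute.refl A).smul_left Δt
  have hJA : Commute (SSPMPRK.jacobian g ystar) A :=
    SSPMPRK.commute_of_mul_left (hu1.mul hu2)
      (((Commute.one_left A).sub_left (hBA.smul_left _)).mul_left
        ((Commute.one_left A).sub_left (hBA.smul_left _)))
      (((Commute.one_left A).sub_left (hBA.smul_left _)).sub_left
        ((hBA.mul_left hBA).smul_left _)) hid
  -- Both parameter cases lie in this range; at `(0, 1 / 2)` the bound equals 1.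
  have hstab : α ≤ 1 / (2 * β) → SSPMPRK.LyapunovStable {y | SSPMPRK.Positive y} g ystar :=
    fun hle => hg.lyapunovStable hαβ hle hMetzler hCons hpos hsteady hΔt hgd hD hJA hJ
  refine ⟨?_, ⟨hgd.hasFDerivAt.differentiableAt, hJ⟩, fun hlt _ => hstab hlt.le, fun hor _ => hstab ?_⟩
  · rw [hg.eq_stepMap hαβ hMetzler hCons hΔt hpos]
    exact SSPMPRK.stepMap_of_mulVec_eq_zero hαβ hM hC hpos hB
  · rcases hor with h | h
    · exact h.le
    · rw [Prod.mk.injEq] at h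
      rw [h.1, h.2]
      norm_num
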